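/- Let $\kappa$ be a regular uncountable cardinal and let $X$ be a set of ordinals with $\kappa\subseteq X$. For a cardinal $\mu$ and a set $x$ put $P_\mu x=\{y\subseteq x : |y|<\mu\}$. For $x\subseteq X$ let $\kappa_x=|x\cap\kappa|$ (so $\kappa_X=\kappa$ and $P_{\kappa_X}X=P_\kappa X$), and for $x,y\in P_\kappa X$ write $y\prec x$ if $y\subseteq x$ and $|y|<\kappa_x$. *Strong stationarity.* Let $\mu$ be a cardinal and $Z$ a set of ordinals with $\mu\subseteq Z$. A set $S$ is strongly stationary in $P_\mu Z$ if for every $f:P_\mu Z\to P_\mu Z$ there is $y\in S\cap P_\mu Z$ such that $y\cap\mu\neq\emptyset$ and $f(z)\subseteq y$ for all $z\subseteq y$ with $|z|<|y\cap\mu|$. *$\xi$-s-strong stationarity.* Let $x\in P_\kappa X$ or $x=X$, and $A\subseteq P_\kappa X$. The set $A$ is $0$-s-strongly stationary in $P_{\kappa_x}x$ if for every $y\in P_{\kappa_x}x$ there is $z\in A\cap P_{\kappa_x}x$ with $y\prec z$. For an ordinal $\xi>0$, $A$ is $\xi$-s-strongly stationary in $P_{\kappa_x}x$ if $\kappa_x$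 is a (nonzero) limit cardinal and, for all $\zeta<\xi$ and all $S,T\subseteq P_\kappa X$ that are $\zeta$-s-strongly stationary in $P_{\kappa_x}x$, there is $y\in A\cap P_{\kappa_x}x$ such that $S$ and $T$ are both $\zeta$-s-strongly stationary in $P_{\kappa_y}y$. *Indescribability.* For a cardinal $\mu$ and a set $Z$ of ordinals let $V_0(\mu,Z)=Z$, $V_{\alpha+1}(\mu,Z)=\{y\subseteq V_\alpha(\mu,Z):|y|<\mu\}\cup V_\alpha(\mu,Z)$, and $V_\alpha(\mu,Z)=\bigcup_{\eta<\alpha}V_\eta(\mu,Z)$ for limit $\alpha$. The space $P_\kappa X$ is $\Pi^1_1$-indescribable if for all $R_0,\dots,R_{n-1}\subseteq V_\kappa(\kappa,X)$ and every $\Pi^1_1$ sentence $\varphi$ (universal quantifiers over subsets of the domain followed by a formula with only first-order quantifiers) with $(V_\kappa(\kappa,X),\in,R_0,\dots,R_{n-1})\models\varphi$, there is $x\in P_\kappa X$ with $x\cap\kappa=\kappa_x$ and $$(V_{\kappa_x}(\kappa_x,x),\in,R_0\cap V_{\kappa_x}(\kappa_x,x),\dots,R_{n-1}\cap V_{\kappa_x}(\kappa_x,x))\models\varphi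 .$$ **Proposition.** Suppose $P_\kappa X$ is $\Pi^1_1$-indescribable. Then a set $A\subseteq P_\kappa X$ is $2$-s-strongly stationary in $P_\kappa X$ if and only if for every pair $S,T$ of strongly stationary subsets of $P_\kappa X$ there is an $x\in A$ such that $x\cap\kappa=\kappa_x$ is a Mahlo cardinal and the sets $S$ and $T$ are both strongly stationary in $P_{\kappa_x}x$. -/

import Mathlib

universe u

open Cardinal Order

namespace TwoCardinal

/-! Sets are elements of `ZFSet`, ordinals are von Neumann ordinals, and a cardinal `κ` is
identified, as a set, with its initial ordinal `ordSet κ`. -/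

/-- The cardinal `κ` as a set of ordinals. -/
noncomputable def ordSet (κ : Cardinal.{u}) : ZFSet.{u} := κ.ord.toZFSet

/-- `P_κ X`: the subsets of `X` of cardinality less than `κ`. -/
def Pk (κ : Cardinal.{u}) (X : ZFSet.{u}) : Set ZFSet.{u} :=
  {x | x ⊆ X ∧ x.card < κ}

/-- `κ_x = |x ∩ κ|`. -/
noncomputable def kap (κ : Cardinal.{u}) (x : ZFSet.{u}) : Cardinal.{u} :=
  (x ∩ ordSet κ).card

/-- `x ≺ y`: `x ⊆ y` and `|x| < κ_y`. -/
def Prec (κ : Cardinal.{u}) (x y : ZFSet.{u}) : Prop :=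
  x ⊆ y ∧ x.card < kap κ y

/-- `κ` is (strongly) Mahlo: inaccessible, with stationarily many regular cardinals below. -/
def IsMahlo (κ : Cardinal.{u}) : Prop :=
  κ.IsInaccessible ∧
    IsStationary {α : Set.Iio κ.ord | ∃ μ : Cardinal.{u}, μ.IsRegular ∧ μ.ord = α.1}

/-- `B_f` for a function `f` on `P_κ X`. -/
def closureSet (κ : Cardinal.{u}) (X : ZFSet.{u}) (f : ZFSet.{u} → ZFSet.{u}) :
    Set ZFSet.{u} :=
  {x | x ∈ Pk κ X ∧ x ∩ ordSet κ ≠ ∅ ∧ ∀ y ∈ Pk (kap κ x) x, f y ⊆ x}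

/-- `S` is strongly stationary in `P_κ X`: it meets `B_f` for every `f : P_κ X → P_κ X`. -/
def IsStronglyStationary (κ : Cardinal.{u}) (X : ZFSet.{u}) (S : Set ZFSet.{u}) : Prop :=
  ∀ f : ZFSet.{u} → ZFSet.{u}, Set.MapsTo f (Pk κ X) (Pk κ X) →
    (S ∩ closureSet κ X f).Nonempty

/-- `A` is `≺`-cofinal in `P_{κ_x} x`, where `≺` and `κ_x` are computed from `κ`. -/
def IsPrecCofinal (κ : Cardinal.{u}) (A : Set ZFSet.{u}) (x : ZFSet.{u}) : Prop :=
  ∀ y ∈ Pk (kap κ x) x, ∃ z ∈ A ∩ Pk (kap κ x) x, Prec κ y z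

/-- `A` is `ξ`-s-strongly stationary in `P_{κ_x} x`, in the ambient space `P_κ X`.
As `κ_X = κ` when `κ ⊆ X` (see `kap_self`), the case `x = X` says that `A` is
`ξ`-s-strongly stationary in `P_κ X`. -/
def IsSStronglyStationary (κ : Cardinal.{u}) (X : ZFSet.{u}) (ξ : Ordinal.{u})
    (A : Set ZFSet.{u}) (x : ZFSet.{u}) : Prop :=
  (ξ = 0 → IsPrecCofinal κ A x) ∧
  (ξ ≠ 0 → IsSuccLimit (kap κ x) ∧
    ∀ ζ : Ordinal.{u}, ∀ _ : ζ < ξ, ∀ S T : Set ZFSet.{u}, S ⊆ Pk κ X → T ⊆ Pk κ X →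
      IsSStronglyStationary κ X ζ S x → IsSStronglyStationary κ X ζ T x →
      ∃ y ∈ A ∩ Pk (kap κ x) x,
        IsSStronglyStationary κ X ζ S y ∧ IsSStronglyStationary κ X ζ T y)
termination_by ξ

theorem kap_self {κ : Cardinal.{u}} {X : ZFSet.{u}} (h : ordSet κ ⊆ X) : kap κ X = κ := by
  have : X ∩ ordSet κ = ordSet κ := by
    ext z
    simp only [ZFSet.mem_inter]
    exact ⟨fun hz => hz.2, fun hz => ⟨h hz, hz⟩⟩
  rw [kap, this, ordSet, Ordinal.card_toZFSet, Cardinal.card_ord]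

theorem isSStronglyStationary_zero {κ : Cardinal.{u}} {X : ZFSet.{u}} {A : Set ZFSet.{u}}
    {x : ZFSet.{u}} : IsSStronglyStationary κ X 0 A x ↔ IsPrecCofinal κ A x := by
  rw [IsSStronglyStationary]
  simp

theorem isSStronglyStationary_of_ne_zero {κ : Cardinal.{u}} {X : ZFSet.{u}} {ξ : Ordinal.{u}}
    (hξ : ξ ≠ 0) {A : Set ZFSet.{u}} {x : ZFSet.{u}} :
    IsSStronglyStationary κ X ξ A x ↔ IsSuccLimit (kap κ x) ∧
      ∀ ζ < ξ, ∀ S T : Set ZFSet.{u}, S ⊆ Pk κ X → T ⊆ Pk κ X →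
        IsSStronglyStationary κ X ζ S x → IsSStronglyStationary κ X ζ T x →
        ∃ y ∈ A ∩ Pk (kap κ x) x,
          IsSStronglyStationary κ X ζ S y ∧ IsSStronglyStationary κ X ζ T y := by
  conv_lhs => rw [IsSStronglyStationary]
  simp [hξ]

/-- The two-cardinal cumulative hierarchy `V_α(κ, X)`: `V_0 = X`,
`V_{α+1} = P_κ(V_α) ∪ V_α`, and unions at limits. -/
noncomputable def hier (κ : Cardinal.{u}) (X : ZFSet.{u}) (α : Ordinal.{u}) :
    Set ZFSet.{u} :=
  Ordinal.limitRecOn α (X : Set ZFSet.{u})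
    (fun _ W => {y : ZFSet.{u} | (y : Set ZFSet.{u}) ⊆ W ∧ y.card < κ} ∪ W)
    (fun o _ W => ⋃ (η : Ordinal.{u}) (h : η < o), W η h)

theorem hier_zero (κ : Cardinal.{u}) (X : ZFSet.{u}) :
    hier κ X 0 = (X : Set ZFSet.{u}) := by
  simp [hier]

theorem hier_add_one (κ : Cardinal.{u}) (X : ZFSet.{u}) (α : Ordinal.{u}) :
    hier κ X (α + 1) =
      {y : ZFSet.{u} | (y : Set ZFSet.{u}) ⊆ hier κ X α ∧ y.card < κ} ∪ hier κ X α := by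
  simp only [hier, Ordinal.limitRecOn_add_one]

theorem hier_limit (κ : Cardinal.{u}) (X : ZFSet.{u}) {α : Ordinal.{u}}
    (hα : IsSuccLimit α) : hier κ X α = ⋃ (η : Ordinal.{u}) (_ : η < α), hier κ X η := by
  simp only [hier]
  rw [Ordinal.limitRecOn_limit _ _ _ _ hα]

/-- Relation symbols: the binary symbol `∈` and unary predicates indexed by `ι`. -/
inductive SetRel (ι : Type) : ℕ → Type
  | mem : SetRel ι 2
  | pred (i : ι) : SetRel ι 1

/-- The language of set theory with unary predicate symbols indexed by `ι`. -/
def setLang (ι : Type) : FirstOrder.Language.{0, 0} := ⟨fun _ => Empty, SetRel ι⟩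

/-- The structure `(D, ∈, (P_i ∩ D)_{i ∈ ι})`. -/
@[reducible]
def setStructure {ι : Type} (D : Set ZFSet.{u}) (P : ι → Set ZFSet.{u}) :
    (setLang ι).Structure D where
  funMap := fun f => Empty.elim f
  RelMap := fun {_} r =>
    match r with
    | SetRel.mem => fun v => (v 0 : ZFSet.{u}) ∈ (v 1 : ZFSet.{u})
    | SetRel.pred i => fun v => (v 0 : ZFSet.{u}) ∈ P i

/-- `(D, ∈, R_0, …, R_{n-1}) ⊨ ∀ Y_0 ⋯ ∀ Y_{k-1} φ`, where the second-order variables `Y_j`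
range over subsets of `D` and `φ` has only first-order quantifiers; the predicate symbols of `φ`
stand for the `R_i` (left summand) and the `Y_j` (right summand).
So this is truth of a `Π^1_1` sentence. -/
def RealizesPi11 {n k : ℕ} (D : Set ZFSet.{u}) (R : Fin n → Set ZFSet.{u})
    (φ : (setLang (Fin n ⊕ Fin k)).Sentence) : Prop :=
  ∀ Y : Fin k → Set ZFSet.{u}, (∀ j, Y j ⊆ D) →
    @FirstOrder.Language.Sentence.Realize (setLang (Fin n ⊕ Fin k)) D
      (setStructure D (Sum.elim R Y)) φ

/-- `S ⊆ P_κ X` is `Π^1_1`-indescribable in `P_κ X`. -/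
def IsPi11Indescribable (κ : Cardinal.{u}) (X : ZFSet.{u}) (S : Set ZFSet.{u}) : Prop :=
  ∀ (n k : ℕ) (R : Fin n → Set ZFSet.{u}) (φ : (setLang (Fin n ⊕ Fin k)).Sentence),
    (∀ i, R i ⊆ hier κ X κ.ord) →
    RealizesPi11 (hier κ X κ.ord) R φ →
    ∃ x ∈ S, x ∩ ordSet κ = ordSet (kap κ x) ∧
      RealizesPi11 (hier (kap κ x) x (kap κ x).ord)
        (fun i => R i ∩ hier (kap κ x) x (kap κ x).ord) φ

end TwoCardinal

open TwoCardinal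

namespace TwoCardinal

/-! ### Cardinal arithmetic of sets, and the trace `x ∩ κ` -/

section ZFSetCardinals

variable {κ μ : Cardinal.{u}} {x y z : ZFSet.{u}} {a b : Ordinal.{u}}

/-! For `f : P_κ X → P_κ X` let `B_f` (`closureSet`) be the set of closure points of `f`. The heart
of the matter is that over a Mahlo `κ`, being 1-s-strongly stationary and being strongly stationary
agree, up to degenerate points `y` with `κ_y = 0`, at which every set is vacuously `≺`-cofinal. If
`U` is `≺`-cofinal, some `B_f` consists of points at which `U` stays cofinal, so a strongly
stationary set reflects cofinal sets. Conversely, when `κ` is Mahlo each `B_f` is itself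
`≺`-cofinal, and a nondegenerate `y` at which `B_f` is cofinal belongs to `B_f`.

Indescribability serves only to make `P_κ X` strongly stationary and `κ` inaccessible; together
these make `κ` Mahlo.

Forward direction: shrink `S` and `T` to points with `κ_z` inaccessible. They are 1-s-strongly
stationary, so both reflect to some `x ∈ A`. A 1-s-strongly stationary set of inaccessible points
forces `κ_x` to be Mahlo and equal to `x ∩ κ` (`IsSStronglyStationary.isMahlo_kap`), and the
equivalence can then be applied inside `P_{κ_x} x`.

Backward direction: replace each `ζ`-s-strongly stationary set, `ζ < 2`, by a strongly stationary
witness whose reflection at a Mahlo point brings the original along (`TransfersTo`), then reflect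
the two witnesses. -/

theorem mem_ordSet : z ∈ ordSet κ ↔ ∃ a < κ.ord, a.toZFSet = z := Ordinal.mem_toZFSet_iff

@[simp]
theorem toZFSet_mem_ordSet : a.toZFSet ∈ ordSet κ ↔ a < κ.ord :=
  Ordinal.toZFSet_mem_toZFSet_iff

@[simp]
theorem card_ordSet (κ : Cardinal.{u}) : (ordSet κ).card = κ := by
  rw [ordSet, Ordinal.card_toZFSet, Cardinal.card_ord]

@[simp]
theorem ordSet_subset_ordSet : ordSet μ ⊆ ordSet κ ↔ μ ≤ κ := by
  rw [ordSet, ordSet, Ordinal.toZFSet_subset_toZFSet_iff, ord_le_ord]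

@[simp]
theorem toZFSet_subset_ordSet : a.toZFSet ⊆ ordSet κ ↔ a ≤ κ.ord :=
  Ordinal.toZFSet_subset_toZFSet_iff

/-- The union `⋃_{y ∈ x} F y`. -/
noncomputable def biUnion (x : ZFSet.{u}) (F : ZFSet.{u} → ZFSet.{u}) : ZFSet.{u} :=
  ZFSet.iUnion fun i : Shrink.{u} x => F ((equivShrink x).symm i)

@[simp]
theorem mem_biUnion {F : ZFSet.{u} → ZFSet.{u}} : z ∈ biUnion x F ↔ ∃ y ∈ x, z ∈ F y := by
  rw [biUnion, ZFSet.mem_iUnion, (equivShrink x).symm.exists_congr_left]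
  simp

theorem card_union_lt (hκ : ℵ₀ ≤ κ) (hx : x.card < κ) (hy : y.card < κ) : (x ∪ y).card < κ :=
  ZFSet.card_union_le.trans_lt (add_lt_of_lt hκ hx hy)

theorem card_insert_lt (hκ : ℵ₀ ≤ κ) (hy : y.card < κ) : (insert x y).card < κ :=
  ZFSet.card_insert_le.trans_lt (add_lt_of_lt hκ hy (one_lt_aleph0.trans_le hκ))

theorem card_biUnion_lt (hκ : κ.IsRegular) (hx : x.card < κ) {F : ZFSet.{u} → ZFSet.{u}}
    (hF : ∀ y ∈ x, (F y).card < κ) : (biUnion x F).card < κ := by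
  have h := ZFSet.lift_card_iUnion_le_sum_card (f := fun i : Shrink.{u} x =>
    F ((equivShrink x).symm i))
  rw [Cardinal.lift_id] at h
  exact h.trans_lt (sum_lt_of_isRegular hκ hx fun i => hF _ ((equivShrink x).symm i).2)

theorem exists_subset_card_eq (h : μ ≤ x.card) : ∃ s ⊆ x, s.card = μ := by
  rw [← lift_le.{u + 1}, ← ZFSet.cardinalMk_coe_sort] at h
  obtain ⟨p, hp, hpμ⟩ := le_mk_iff_exists_subset.1 h
  refine ⟨x.sep (· ∈ p), ZFSet.sep_subset, ?_⟩
  rw [← lift_inj.{u, u + 1}, ← ZFSet.cardinalMk_coe_sort, ← hpμ]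
  have : ((x.sep (· ∈ p) : ZFSet.{u}) : Set ZFSet.{u}) = p := by
    ext z; simpa using fun hz => hp hz
  exact congrArg (fun s : Set ZFSet.{u} => #s) this

/-- Subsets of `κ` of size less than a regular cardinal `κ` are bounded. -/
theorem exists_bound_of_card_lt (hκ : κ.IsRegular) (hx : x.card < κ) :
    ∃ β < κ.ord, ∀ a < κ.ord, a.toZFSet ∈ x → a < β := by
  have hκ0 : 0 < κ.ord := hκ.ord_pos
  refine ⟨⨆ y : Shrink.{u} x, (if (((equivShrink x).symm y : x) : ZFSet.{u}).rank < κ.ord then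
    (((equivShrink x).symm y : x) : ZFSet.{u}).rank else 0) + 1, ?_, ?_⟩
  · apply Ordinal.iSup_add_one_lt_of_lt_cof
    · rw [hκ.cof_ord]; exact hx
    · intro i; split_ifs with h
      · exact h
      · exact hκ0
  · intro a ha hax
    have := Ordinal.lt_iSup_add_one (fun y : Shrink.{u} x =>
      (if (((equivShrink x).symm y : x) : ZFSet.{u}).rank < κ.ord then
        (((equivShrink x).symm y : x) : ZFSet.{u}).rank else 0)) (equivShrink x ⟨_, hax⟩)
    simpa [ha] using this

/-- If the cofinality were smaller than `κ`, a cofinal set of that size would be bounded. -/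
theorem isRegular_of_exists_bound (hκ : ℵ₀ ≤ κ)
    (h : ∀ x ⊆ ordSet κ, x.card < κ → ∃ β < κ.ord, ∀ a, a.toZFSet ∈ x → a < β) :
    κ.IsRegular := by
  refine ⟨hκ, ?_⟩
  by_contra! hlt
  rw [← Ordinal.cof_toType] at hlt
  obtain ⟨s, hs, hsc⟩ := Order.exists_cof_eq κ.ord.ToType
  rw [← hsc] at hlt
  let e : Set.Iio κ.ord ≃o κ.ord.ToType := Ordinal.ToType.mk
  let F : s → ZFSet.{u} := fun i => (e.symm i.1).1.toZFSet
  obtain ⟨β, hβ, hβx⟩ := h (ZFSet.range F) (by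
      intro z hz
      obtain ⟨i, rfl⟩ := ZFSet.mem_range.1 hz
      exact toZFSet_mem_ordSet.2 (e.symm i.1).2) (by
      simpa using (ZFSet.lift_card_range_le (f := F)).trans_lt (by simpa using hlt))
  obtain ⟨i, hi, hle⟩ := hs (e ⟨β, hβ⟩)
  have h1 := hβx (e.symm i).1 (ZFSet.mem_range.2 ⟨⟨i, hi⟩, rfl⟩)
  have h2 : (⟨β, hβ⟩ : Set.Iio κ.ord) ≤ e.symm i := by
    rw [OrderIso.le_symm_apply]; exact hle
  exact absurd h1 (not_lt.2 h2)

theorem kap_mono (h : x ⊆ y) : kap κ x ≤ kap κ y :=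
  ZFSet.card_mono fun _ hz => ZFSet.mem_inter.2
    ⟨h (ZFSet.mem_inter.1 hz).1, (ZFSet.mem_inter.1 hz).2⟩

theorem kap_le_card : kap κ x ≤ x.card :=
  ZFSet.card_mono fun _ hz => (ZFSet.mem_inter.1 hz).1

theorem le_kap_of_subset (h : ordSet μ ⊆ x) (hμ : μ ≤ κ) : μ ≤ kap κ x := by
  rw [← card_ordSet μ]
  exact ZFSet.card_mono fun z hz => ZFSet.mem_inter.2 ⟨h hz, ordSet_subset_ordSet.2 hμ hz⟩

theorem kap_lt_of_mem_Pk {X : ZFSet.{u}} (h : x ∈ Pk κ X) : kap κ x < κ :=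
  kap_le_card.trans_lt h.2

theorem inter_ordSet_eq (hx : x ∩ ordSet κ = ordSet μ) (hzx : z ⊆ x) :
    z ∩ ordSet κ = z ∩ ordSet μ := by
  ext w
  simp only [ZFSet.mem_inter, ← hx]
  exact ⟨fun h => ⟨h.1, hzx h.1, h.2⟩, fun h => ⟨h.1, h.2.2⟩⟩

theorem ordSet_subset_of_inter_eq (hx : x ∩ ordSet κ = ordSet μ) : ordSet μ ⊆ x := by
  rw [← hx]; exact fun _ h => (ZFSet.mem_inter.1 h).1

theorem kap_eq_kap (hx : x ∩ ordSet κ = ordSet μ) (hzx : z ⊆ x) : kap κ z = kap μ z := by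
  rw [kap, kap, inter_ordSet_eq hx hzx]

/-- If `x ∩ κ` is covered by cardinals contained in `x`, then it is the cardinal `κ_x`. -/
theorem inter_ordSet_eq_ordSet_kap
    (h : ∀ a < κ.ord, a.toZFSet ∈ x → ∃ ν ≤ κ, a < ν.ord ∧ ordSet ν ⊆ x) :
    x ∩ ordSet κ = ordSet (kap κ x) := by
  have hsub : x ∩ ordSet κ ⊆ ordSet (kap κ x) := by
    intro z hz
    obtain ⟨hzx, hzκ⟩ := ZFSet.mem_inter.1 hz
    obtain ⟨a, ha, rfl⟩ := mem_ordSet.1 hzκ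
    obtain ⟨ν, hν, haν, hνx⟩ := h a ha hzx
    exact toZFSet_mem_ordSet.2 (haν.trans_le (ord_le_ord.2 (le_kap_of_subset hνx hν)))
  refine le_antisymm hsub fun z hz => ?_
  obtain ⟨b, hb, rfl⟩ := mem_ordSet.1 hz
  by_contra hbx
  have hsub' : x ∩ ordSet κ ⊆ b.toZFSet := by
    intro z hz
    obtain ⟨hzx, hzκ⟩ := ZFSet.mem_inter.1 hz
    obtain ⟨a, ha, rfl⟩ := mem_ordSet.1 hzκ
    rw [Ordinal.toZFSet_mem_toZFSet_iff]
    by_contra! hle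
    obtain ⟨ν, hν, haν, hνx⟩ := h a ha hzx
    exact hbx (ZFSet.mem_inter.2 ⟨hνx (toZFSet_mem_ordSet.2 (hle.trans_lt haν)),
      toZFSet_mem_ordSet.2 (hle.trans_lt ha)⟩)
  have := ZFSet.card_mono hsub'
  rw [Ordinal.card_toZFSet] at this
  exact absurd (lt_ord.1 hb) (not_lt.2 this)

end ZFSetCardinals

/-! ### Closure points from indescribability -/

section Indescribability

variable {κ μ : Cardinal.{u}} {X x : ZFSet.{u}}

theorem mem_ordSet_iff_card_lt {z : ZFSet.{u}} (hz : z.IsOrdinal) : z ∈ ordSet κ ↔ z.card < κ := by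
  obtain ⟨a, rfl⟩ := ZFSet.isOrdinal_iff_mem_range_toZFSet.1 hz
  rw [toZFSet_mem_ordSet, Ordinal.card_toZFSet, lt_ord]

theorem mem_ordSet_of_mem {y z : ZFSet.{u}} (hzy : z ∈ y) (hy : y ∈ ordSet κ) : z ∈ ordSet κ :=
  (ZFSet.isOrdinal_toZFSet _).mem_trans hzy hy

theorem hier_mono (κ : Cardinal.{u}) (X : ZFSet.{u}) : Monotone (hier κ X) := by
  intro α β
  induction β using Ordinal.limitRecOn with
  | zero => intro h; rw [nonpos_iff_eq_zero.1 h]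
  | add_one β ih =>
    intro h
    rcases h.eq_or_lt with rfl | h
    · rfl
    · rw [hier_add_one]
      exact (ih (Order.lt_add_one_iff.1 h)).trans Set.subset_union_right
  | limit β hβ _ =>
    intro h
    rcases h.eq_or_lt with rfl | h
    · rfl
    · rw [hier_limit κ X hβ]
      exact Set.subset_biUnion_of_mem (u := fun η => hier κ X η) h

theorem Pk_subset_hier_one (κ : Cardinal.{u}) (X : ZFSet.{u}) : Pk κ X ⊆ hier κ X 1 := by
  intro y hy
  rw [← zero_add (1 : Ordinal.{u}), hier_add_one, hier_zero]
  exact Or.inl hy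

/-- The hierarchy over `x` is not transitive, since an ordinal of `x` above `κ` may have elements
outside `x`. The bound `p.card < κ` repairs this at level zero: such an ordinal `p` lies in `x ∩ κ =
μ`, which is transitive. -/
theorem mem_hier_of_mem (hx : x ∩ ordSet κ = ordSet μ) (hord : ∀ α ∈ x, ZFSet.IsOrdinal α)
    {α : Ordinal.{u}} {p q : ZFSet.{u}} (hp : p ∈ hier μ x α) (hpκ : p.card < κ) (hq : q ∈ p) :
    q ∈ hier μ x α := by
  induction α using Ordinal.limitRecOn with
  | zero =>
    rw [hier_zero] at hp ⊢
    have hpμ : p ∈ ordSet μ := by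
      rw [← hx]
      exact ZFSet.mem_inter.2 ⟨hp, (mem_ordSet_iff_card_lt (hord p hp)).2 hpκ⟩
    have := mem_ordSet_of_mem hq hpμ
    rw [← hx] at this
    exact (ZFSet.mem_inter.1 this).1
  | add_one α ih =>
    rw [hier_add_one] at hp ⊢
    rcases hp with hp | hp
    · exact Or.inr (hp.1 hq)
    · exact Or.inr (ih hp)
  | limit α hα ih =>
    rw [hier_limit μ x hα] at hp ⊢
    obtain ⟨η, hη, hp⟩ := Set.mem_iUnion₂.1 hp
    exact Set.mem_iUnion₂.2 ⟨η, hη, ih η hη hp⟩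

/-- No new ordinals are created: one added at a successor level has size less than `μ`, hence lies
in `μ ⊆ x`. -/
theorem mem_of_mem_hier_of_isOrdinal (hx : ordSet μ ⊆ x) {α : Ordinal.{u}} {z : ZFSet.{u}}
    (hz : z.IsOrdinal) (h : z ∈ hier μ x α) : z ∈ x := by
  induction α using Ordinal.limitRecOn with
  | zero => rwa [hier_zero] at h
  | add_one α ih =>
    rw [hier_add_one] at h
    rcases h with h | h
    · exact hx ((mem_ordSet_iff_card_lt hz).2 h.2)
    · exact ih h
  | limit α hα ih =>
    rw [hier_limit μ x hα] at h
    obtain ⟨η, hη, h⟩ := Set.mem_iUnion₂.1 h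
    exact ih η hη h

/-- The sentence `∃ u ∀ v ∃ p (R p ∧ v ∈ p)`. -/
def coverSentence : (setLang (Fin 1 ⊕ Fin 0)).Sentence :=
  FirstOrder.Language.BoundedFormula.ex <| FirstOrder.Language.BoundedFormula.all <|
    FirstOrder.Language.BoundedFormula.ex <|
    (FirstOrder.Language.Relations.boundedFormula₁
      (SetRel.pred (Sum.inl 0) : (setLang (Fin 1 ⊕ Fin 0)).Relations 1)
      (FirstOrder.Language.Term.var (Sum.inr 2))) ⊓
    (FirstOrder.Language.Relations.boundedFormula₂
      (SetRel.mem : (setLang (Fin 1 ⊕ Fin 0)).Relations 2)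
      (FirstOrder.Language.Term.var (Sum.inr 1))
      (FirstOrder.Language.Term.var (Sum.inr 2)))

theorem realizesPi11_coverSentence {D : Set ZFSet.{u}} {R : Fin 1 → Set ZFSet.{u}} :
    RealizesPi11 D R coverSentence ↔
      D.Nonempty ∧ ∀ v ∈ D, ∃ p ∈ D, p ∈ R 0 ∧ v ∈ p := by
  have key : ∀ Y : Fin 0 → Set ZFSet.{u},
      @FirstOrder.Language.Sentence.Realize (setLang (Fin 1 ⊕ Fin 0)) D
        (setStructure D (Sum.elim R Y)) coverSentence ↔
      D.Nonempty ∧ ∀ v ∈ D, ∃ p ∈ D, p ∈ R 0 ∧ v ∈ p := by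
    intro Y
    let := setStructure D (Sum.elim R Y)
    simp only [FirstOrder.Language.Sentence.Realize, coverSentence,
      FirstOrder.Language.Formula.Realize, FirstOrder.Language.BoundedFormula.realize_ex,
      FirstOrder.Language.BoundedFormula.realize_all,
      FirstOrder.Language.BoundedFormula.realize_inf]
    constructor
    · rintro ⟨a, ha⟩
      refine ⟨⟨a, a.2⟩, fun v hv => ?_⟩
      obtain ⟨p, hp⟩ := ha ⟨v, hv⟩
      exact ⟨p, p.2, hp⟩
    · rintro ⟨⟨a, ha⟩, h⟩
      refine ⟨⟨a, ha⟩, fun v => ?_⟩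
      obtain ⟨p, hpD, hp⟩ := h v v.2
      exact ⟨⟨p, hpD⟩, hp⟩
  exact ⟨fun h => (key Fin.elim0).1 (h _ fun j => j.elim0), fun h Y _ => (key Y).2 h⟩

/-- Every `f : P_κ X → P_κ X` extends to a countable closed family in `V_κ(κ, X)` around
each of its points. -/
theorem exists_closed_family (hunc : ℵ₀ < κ) {f : ZFSet.{u} → ZFSet.{u}}
    (hf : Set.MapsTo f (Pk κ X) (Pk κ X)) {v : ZFSet.{u}} (hv : v ∈ hier κ X κ.ord) :
    ∃ p ∈ hier κ X κ.ord, p.card < κ ∧ v ∈ p ∧ ∀ w ∈ p, w ∈ Pk κ X → f w ∈ p := by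
  classical
  have hlim : IsSuccLimit κ.ord := isSuccLimit_ord hunc.le
  let g : ZFSet.{u} → ZFSet.{u} := fun w => if w ∈ Pk κ X then f w else w
  let p := ZFSet.range fun n : ℕ => g^[n] v
  have hcard : p.card < κ := by
    have h := ZFSet.lift_card_range_le (f := fun n : ℕ => g^[n] v)
    simp only [lift_uzero, mk_nat, lift_aleph0] at h
    exact h.trans_lt hunc
  rw [hier_limit κ X hlim] at hv
  obtain ⟨η, hη, hv⟩ := Set.mem_iUnion₂.1 hv
  have hg : ∀ n, g^[n] v ∈ hier κ X (max η 1) := by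
    intro n
    induction n with
    | zero => exact hier_mono κ X (le_max_left _ _) hv
    | succ n ih =>
      rw [Function.iterate_succ_apply']
      by_cases h : g^[n] v ∈ Pk κ X
      · have : g (g^[n] v) = f (g^[n] v) := if_pos h
        rw [this]
        exact hier_mono κ X (le_max_right _ _) (Pk_subset_hier_one κ X (hf h))
      · have : g (g^[n] v) = g^[n] v := if_neg h
        rwa [this]
  refine ⟨p, ?_, hcard, ZFSet.mem_range.2 ⟨0, rfl⟩, ?_⟩
  · have hlt : max η 1 + 1 < κ.ord := by
      refine hlim.add_one_lt (max_lt hη ?_)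
      simpa using lt_ord.2 (by simpa using one_lt_aleph0.trans hunc)
    refine hier_mono κ X hlt.le ?_
    rw [hier_add_one]
    refine Or.inl ⟨fun z hz => ?_, hcard⟩
    obtain ⟨n, rfl⟩ := ZFSet.mem_range.1 hz
    exact hg n
  · intro w hw hwP
    obtain ⟨n, rfl⟩ := ZFSet.mem_range.1 hw
    refine ZFSet.mem_range.2 ⟨n + 1, ?_⟩
    rw [Function.iterate_succ_apply']
    exact if_pos hwP

/-- Indescribability yields points of `P_κ X` closed under a given function. -/
theorem IsPi11Indescribable.exists_mem_closureSet (hunc : ℵ₀ < κ)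
    (hord : ∀ α ∈ X, ZFSet.IsOrdinal α) (hX : ordSet κ ⊆ X)
    (hind : IsPi11Indescribable κ X (Pk κ X)) {f : ZFSet.{u} → ZFSet.{u}}
    (hf : Set.MapsTo f (Pk κ X) (Pk κ X)) :
    ∃ x ∈ closureSet κ X f, x ∩ ordSet κ = ordSet (kap κ x) := by
  -- Coding `f` by the small families closed under it needs only a unary predicate and no ordered
  -- pairs. After reflection, `v ∈ p ∈ R` gives `f v ∈ p`, and two uses of restricted transitivity
  -- put the elements of `f v` into the reflected domain.
  let R : Fin 1 → Set ZFSet.{u} := fun _ =>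
    {p | p ∈ hier κ X κ.ord ∧ p.card < κ ∧ ∀ w ∈ p, w ∈ Pk κ X → f w ∈ p}
  obtain ⟨x, hxP, hxκ, hφ⟩ := hind 1 0 R coverSentence (fun _ _ hp => hp.1) (by
    refine realizesPi11_coverSentence.2 ⟨⟨∅, hier_mono κ X (zero_le (a := κ.ord)) ?_⟩, fun v hv => ?_⟩
    · rw [hier_zero]
      apply hX
      rw [← Ordinal.toZFSet_zero, toZFSet_mem_ordSet, lt_ord]
      simpa using aleph0_pos.trans hunc
    · obtain ⟨p, hp, hpκ, hvp, hcl⟩ := exists_closed_family hunc hf hv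
      exact ⟨p, hp, ⟨hp, hpκ, hcl⟩, hvp⟩)
  obtain ⟨⟨v₀, hv₀⟩, hφ⟩ := realizesPi11_coverSentence.1 hφ
  have hxo : ∀ α ∈ x, ZFSet.IsOrdinal α := fun α hα => hord α (hxP.1 hα)
  have hsub : ordSet (kap κ x) ⊆ x := ordSet_subset_of_inter_eq hxκ
  -- The leading `∃ u` of the sentence makes the domain nonempty. If `κ_x = 0` the domain is `x`,
  -- and the family `p` would be an ordinal in `x ∩ κ = ∅`.
  have hpos : kap κ x ≠ 0 := by
    intro h0
    obtain ⟨p, hp, hpR, -⟩ := hφ v₀ hv₀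
    rw [h0, ord_zero, hier_zero] at hp
    have : p ∈ x ∩ ordSet κ :=
      ZFSet.mem_inter.2 ⟨hp, (mem_ordSet_iff_card_lt (hxo p hp)).2 hpR.1.2.1⟩
    rw [hxκ, h0, ordSet, ord_zero, Ordinal.toZFSet_zero] at this
    exact ZFSet.notMem_empty _ this
  refine ⟨x, ⟨hxP, ?_, ?_⟩, hxκ⟩
  · intro h
    exact hpos (by rw [kap, h, ZFSet.card_empty])
  · intro v hv
    have hvX : v ∈ Pk κ X := ⟨hv.1.trans hxP.1, hv.2.trans (kap_lt_of_mem_Pk hxP)⟩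
    have h1 : (1 : Ordinal.{u}) ≤ (kap κ x).ord := by
      rw [← ord_one, ord_le_ord, Cardinal.one_le_iff_ne_zero]; exact hpos
    obtain ⟨p, hp, hpR, hvp⟩ := hφ v (hier_mono _ _ h1 (Pk_subset_hier_one _ _ hv))
    have hfv := mem_hier_of_mem hxκ hxo hp hpR.1.2.1 (hpR.1.2.2 v hvp hvX)
    intro a ha
    exact mem_of_mem_hier_of_isOrdinal hsub (hord a ((hf hvX).1 ha))
      (mem_hier_of_mem hxκ hxo hfv (hf hvX).2 ha)

end Indescribability

/-! ### Strong stationarity and inaccessibility -/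

section StrongStationarity

variable {κ μ : Cardinal.{u}} {X x : ZFSet.{u}} {S : Set ZFSet.{u}}

theorem card_eq_zero_iff : x.card = 0 ↔ x = ∅ := by
  refine ⟨fun h => ?_, fun h => by rw [h, ZFSet.card_empty]⟩
  rw [← lift_inj.{u, u + 1}, ← ZFSet.cardinalMk_coe_sort, lift_zero, mk_eq_zero_iff] at h
  exact (ZFSet.eq_empty x).2 fun z hz => h.false ⟨z, hz⟩

theorem empty_mem_Pk (hκ : κ ≠ 0) : ∅ ∈ Pk κ X :=
  ⟨ZFSet.empty_subset X, by rw [ZFSet.card_empty]; exact pos_iff_ne_zero.2 hκ⟩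

theorem singleton_mem_Pk (hκ : 1 < κ) {z : ZFSet.{u}} (hz : z ∈ X) : {z} ∈ Pk κ X :=
  ⟨fun _ hy => (ZFSet.mem_singleton.1 hy) ▸ hz, by rwa [ZFSet.card_singleton]⟩

theorem union_mem_Pk (hκ : ℵ₀ ≤ κ) {y z : ZFSet.{u}} (hy : y ∈ Pk κ X) (hz : z ∈ Pk κ X) :
    y ∪ z ∈ Pk κ X :=
  ⟨fun _ h => (ZFSet.mem_union.1 h).elim (fun h => hy.1 h) fun h => hz.1 h,
    card_union_lt hκ hy.2 hz.2⟩

theorem ordSet_mem_Pk (hX : ordSet κ ⊆ X) (hμ : μ < κ) : ordSet μ ∈ Pk κ X :=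
  ⟨(ordSet_subset_ordSet.2 hμ.le).trans hX, by rwa [card_ordSet]⟩

theorem mem_Pk_trans {y z : ZFSet.{u}} (hx : x ∈ Pk μ y) (hy : y ⊆ z) (hμ : μ ≤ κ) :
    x ∈ Pk κ z :=
  ⟨hx.1.trans hy, hx.2.trans_le hμ⟩

theorem kap_ne_zero (hx : x ∩ ordSet κ ≠ ∅) : kap κ x ≠ 0 :=
  fun h => hx (card_eq_zero_iff.1 h)

theorem closureSet_subset_Pk {f : ZFSet.{u} → ZFSet.{u}} : closureSet κ X f ⊆ Pk κ X :=
  fun _ h => h.1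

theorem kap_ne_zero_of_mem_closureSet {f : ZFSet.{u} → ZFSet.{u}} (hx : x ∈ closureSet κ X f) :
    kap κ x ≠ 0 :=
  kap_ne_zero hx.2.1

theorem closureSet_union_left {f g : ZFSet.{u} → ZFSet.{u}} :
    closureSet κ X (fun w => f w ∪ g w) ⊆ closureSet κ X f :=
  fun _ h => ⟨h.1, h.2.1, fun y hy _ hz => h.2.2 y hy (ZFSet.mem_union.2 (Or.inl hz))⟩

theorem closureSet_union_right {f g : ZFSet.{u} → ZFSet.{u}} :
    closureSet κ X (fun w => f w ∪ g w) ⊆ closureSet κ X g :=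
  fun _ h => ⟨h.1, h.2.1, fun y hy _ hz => h.2.2 y hy (ZFSet.mem_union.2 (Or.inr hz))⟩

theorem IsStronglyStationary.inter_closureSet (hS : IsStronglyStationary κ X S) (hκ : ℵ₀ ≤ κ)
    {f : ZFSet.{u} → ZFSet.{u}} (hf : Set.MapsTo f (Pk κ X) (Pk κ X)) :
    IsStronglyStationary κ X (S ∩ closureSet κ X f) := by
  intro g hg
  obtain ⟨x, hxS, hx⟩ := hS (fun w => f w ∪ g w) fun w hw => union_mem_Pk hκ (hf hw) (hg hw)
  exact ⟨x, ⟨hxS, closureSet_union_left hx⟩, closureSet_union_right hx⟩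

theorem IsStronglyStationary.mono (hS : IsStronglyStationary κ X S) {T : Set ZFSet.{u}}
    (h : S ⊆ T) : IsStronglyStationary κ X T :=
  fun f hf => (hS f hf).mono (Set.inter_subset_inter_left _ h)

/-- Apply strong stationarity to the constant function `v ∪ |v|⁺`: a closure point contains `v` and
has `κ_z ≥ |v|⁺`. -/
theorem IsStronglyStationary.exists_prec (hS : IsStronglyStationary κ X S) (hκ : ℵ₀ ≤ κ)
    (hlim : IsSuccLimit κ) (hX : ordSet κ ⊆ X) {v : ZFSet.{u}} (hv : v ∈ Pk κ X) :
    ∃ z ∈ S ∩ Pk κ X, Prec κ v z := by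
  have hs : succ v.card < κ := hlim.succ_lt hv.2
  obtain ⟨z, hzS, hz⟩ := hS (fun _ => v ∪ ordSet (succ v.card)) fun _ _ =>
    union_mem_Pk hκ hv (ordSet_mem_Pk hX hs)
  have h := hz.2.2 ∅ (empty_mem_Pk (kap_ne_zero_of_mem_closureSet hz))
  refine ⟨z, ⟨hzS, hz.1⟩, fun y hy => h (ZFSet.mem_union.2 (Or.inl hy)), ?_⟩
  exact (lt_succ _).trans_le
    (le_kap_of_subset (fun y hy => h (ZFSet.mem_union.2 (Or.inr hy))) hs.le)

/-- Closure under this function makes `κ_x` an inaccessible cardinal equal to `x ∩ κ`. -/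
noncomputable def inaccessibleClosure (κ : Cardinal.{u}) (w : ZFSet.{u}) : ZFSet.{u} :=
  ordSet (succ (2 ^ (w.card + (biUnion (w ∩ ordSet κ) id).card + ℵ₀)))

theorem mapsTo_inaccessibleClosure (hκ : κ.IsInaccessible) (hX : ordSet κ ⊆ X) :
    Set.MapsTo (inaccessibleClosure κ) (Pk κ X) (Pk κ X) := by
  intro w hw
  refine ordSet_mem_Pk hX (hκ.isSuccLimit.succ_lt (hκ.isStrongPrelimit ?_))
  refine add_lt_of_lt hκ.aleph0_lt.le (add_lt_of_lt hκ.aleph0_lt.le hw.2 ?_) hκ.aleph0_lt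
  refine card_biUnion_lt hκ.isRegular
    ((ZFSet.card_mono fun _ h => (ZFSet.mem_inter.1 h).1).trans_lt hw.2) fun y hy => ?_
  obtain ⟨a, ha, rfl⟩ := mem_ordSet.1 (ZFSet.mem_inter.1 hy).2
  simpa using lt_ord.1 ha

theorem card_le_card_biUnion {w : ZFSet.{u}} {a : Ordinal.{u}} (ha : a < κ.ord)
    (haw : a.toZFSet ∈ w) : a.card ≤ (biUnion (w ∩ ordSet κ) id).card := by
  rw [← Ordinal.card_toZFSet]
  exact ZFSet.card_mono fun z hz =>
    mem_biUnion.2 ⟨_, ZFSet.mem_inter.2 ⟨haw, toZFSet_mem_ordSet.2 ha⟩, hz⟩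

/-- Each summand of the exponent has its own task: `|w|` gives the strong limit property, `ℵ₀` gives
uncountability, and `|⋃ (w ∩ κ)|` bounds the ordinals in `w`, which yields both `x ∩ κ = κ_x`
(singletons `w`) and regularity (small `w ⊆ κ_x`). -/
theorem isInaccessible_kap_of_mem_closureSet (hκ : κ.IsInaccessible) (hX : ordSet κ ⊆ X)
    (hx : x ∈ closureSet κ X (inaccessibleClosure κ)) :
    x ∩ ordSet κ = ordSet (kap κ x) ∧ (kap κ x).IsInaccessible := by
  set θ : ZFSet.{u} → Cardinal.{u} := fun w => w.card + (biUnion (w ∩ ordSet κ) id).card + ℵ₀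
    with hθ
  have hθc (w : ZFSet.{u}) : w.card ≤ θ w := by
    simp only [hθ, add_assoc]; exact self_le_add_right _ _
  have hθu (w : ZFSet.{u}) : (biUnion (w ∩ ordSet κ) id).card ≤ θ w := by
    simp only [hθ]; exact (self_le_add_left _ _).trans (self_le_add_right _ _)
  have hθκ (w : ZFSet.{u}) (hw : w ∈ Pk (kap κ x) x) : succ (2 ^ θ w) < κ := by
    have := (mapsTo_inaccessibleClosure hκ hX
      (mem_Pk_trans hw hx.1.1 (kap_lt_of_mem_Pk hx.1).le)).2
    rwa [inaccessibleClosure, card_ordSet] at this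
  have hsub (w : ZFSet.{u}) (hw : w ∈ Pk (kap κ x) x) : ordSet (succ (2 ^ θ w)) ⊆ x :=
    hx.2.2 w hw
  have hle (w : ZFSet.{u}) (hw : w ∈ Pk (kap κ x) x) : 2 ^ θ w < kap κ x :=
    (lt_succ _).trans_le (le_kap_of_subset (hsub w hw) (hθκ w hw).le)
  have hω : ℵ₀ < kap κ x := by
    refine lt_of_le_of_lt ?_ (hle ∅ (empty_mem_Pk (kap_ne_zero_of_mem_closureSet hx)))
    exact (self_le_add_left _ _).trans (cantor _).le
  have heq : x ∩ ordSet κ = ordSet (kap κ x) := by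
    refine inter_ordSet_eq_ordSet_kap fun a ha hax => ?_
    have hw := singleton_mem_Pk (one_lt_aleph0.trans hω) hax
    refine ⟨_, (hθκ _ hw).le, ?_, hsub _ hw⟩
    rw [lt_ord]
    exact ((card_le_card_biUnion ha (ZFSet.mem_singleton.2 rfl)).trans (hθu _)).trans_lt
      ((cantor _).trans (lt_succ _))
  have hxs : ordSet (kap κ x) ⊆ x := ordSet_subset_of_inter_eq heq
  refine ⟨heq, isInaccessible_def.2 ⟨hω, ?_, hω.ne_bot, ?_⟩⟩
  · refine isRegular_of_exists_bound hω.le fun c hc hcc => ?_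
    refine ⟨((2 : Cardinal.{u}) ^ θ c).ord, ord_lt_ord.2 (hle c ⟨hc.trans hxs, hcc⟩), fun a ha => ?_⟩
    have haκ : a < κ.ord := (toZFSet_mem_ordSet.1 (hc ha)).trans
      (ord_lt_ord.2 (kap_lt_of_mem_Pk hx.1))
    rw [lt_ord]
    exact ((card_le_card_biUnion haκ ha).trans (hθu c)).trans_lt (cantor _)
  · intro ν hν
    have hw : ordSet ν ∈ Pk (kap κ x) x := ordSet_mem_Pk hxs hν
    refine lt_of_le_of_lt ?_ (hle _ hw)
    refine power_le_power_left two_ne_zero ?_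
    simpa using hθc (ordSet ν)

/-- If `κ ≤ 2 ^ ν`, code the ordinals below `κ` by subsets of `ν` and let `c` decode. A closure
point `x` of `c` with `ν < κ_x` contains every `z < κ`, since all codes lie in `P_{κ_x} x`. Taking
`z = κ_x` contradicts `x ∩ κ = κ_x`. -/
theorem IsPi11Indescribable.isInaccessible (hreg : κ.IsRegular) (hunc : ℵ₀ < κ)
    (hord : ∀ α ∈ X, ZFSet.IsOrdinal α) (hX : ordSet κ ⊆ X)
    (hind : IsPi11Indescribable κ X (Pk κ X)) : κ.IsInaccessible := by
  refine ⟨hunc, hreg.le_cof_ord, fun ν hν => ?_⟩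
  by_contra! hle
  obtain ⟨e⟩ : Nonempty (ordSet κ ↪ (ordSet ν).powerset) := by
    rw [← Cardinal.le_def, ZFSet.cardinalMk_coe_sort, ZFSet.cardinalMk_coe_sort, lift_le]
    simpa using hle
  let c : ZFSet.{u} → ZFSet.{u} :=
    Function.extend (fun z => (e z : ZFSet.{u})) (fun z => {z.1}) fun _ => ∅
  have hc (z : ordSet κ) : c (e z) = {z.1} :=
    (Subtype.val_injective.comp e.injective).extend_apply _ _ z
  have hcP (v : ZFSet.{u}) : c v ∈ Pk κ X := by
    by_cases h : ∃ z, (e z : ZFSet.{u}) = v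
    · obtain ⟨z, rfl⟩ := h
      rw [hc]
      exact singleton_mem_Pk (one_lt_aleph0.trans hunc) (hX z.2)
    · have : c v = ∅ := Function.extend_apply' _ _ _ h
      rw [this]
      exact empty_mem_Pk hreg.ne_zero
  have hν1 : ν.ord + 1 < κ.ord :=
    (isSuccLimit_ord hunc.le).add_one_lt (ord_lt_ord.2 hν)
  have hνP : (ν.ord + 1).toZFSet ∈ Pk κ X :=
    ⟨(toZFSet_subset_ordSet.2 hν1.le).trans hX, by rw [Ordinal.card_toZFSet]; exact lt_ord.1 hν1⟩
  -- The values contain `ν + 1` rather than `ν`, so that `ν` itself becomes an element of `x ∩ κ =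
  -- κ_x`.
  obtain ⟨x, hx, hxκ⟩ := hind.exists_mem_closureSet hunc hord hX
    (f := fun v => (ν.ord + 1).toZFSet ∪ c v) fun v _ => union_mem_Pk hunc.le hνP (hcP v)
  have hνx : ν < kap κ x := by
    have h := hx.2.2 ∅ (empty_mem_Pk (kap_ne_zero_of_mem_closureSet hx)) (ZFSet.mem_union.2
      (Or.inl (Ordinal.toZFSet_mem_toZFSet_iff.2 (lt_add_one ν.ord))))
    have h' : ν.ord.toZFSet ∈ x ∩ ordSet κ :=
      ZFSet.mem_inter.2 ⟨h, toZFSet_mem_ordSet.2 (ord_lt_ord.2 hν)⟩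
    rw [hxκ, toZFSet_mem_ordSet, ord_lt_ord] at h'
    exact h'
  have hxs : ordSet (kap κ x) ⊆ x := ordSet_subset_of_inter_eq hxκ
  let z : ordSet κ := ⟨(kap κ x).ord.toZFSet,
    toZFSet_mem_ordSet.2 (ord_lt_ord.2 (kap_lt_of_mem_Pk hx.1))⟩
  have hez : (e z : ZFSet.{u}) ⊆ ordSet ν := ZFSet.mem_powerset.1 (e z).2
  have hzx : z.1 ∈ x := by
    refine hx.2.2 (e z) ⟨hez.trans ((ordSet_subset_ordSet.2 hνx.le).trans hxs), ?_⟩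
      (ZFSet.mem_union.2 (Or.inr (by rw [hc]; exact ZFSet.mem_singleton.2 rfl)))
    exact (ZFSet.card_mono hez).trans_lt (by rwa [card_ordSet])
  have : z.1 ∈ x ∩ ordSet κ := ZFSet.mem_inter.2 ⟨hzx, z.2⟩
  rw [hxκ] at this
  exact lt_irrefl _ (toZFSet_mem_ordSet.1 this)

theorem IsPi11Indescribable.isStronglyStationary_Pk (hunc : ℵ₀ < κ)
    (hord : ∀ α ∈ X, ZFSet.IsOrdinal α) (hX : ordSet κ ⊆ X)
    (hind : IsPi11Indescribable κ X (Pk κ X)) : IsStronglyStationary κ X (Pk κ X) := by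
  intro f hf
  obtain ⟨x, hx, -⟩ := hind.exists_mem_closureSet hunc hord hX hf
  exact ⟨x, hx.1, hx⟩

end StrongStationarity

/-! ### Clubs and Mahlo cardinals -/

section Mahlo

variable {κ : Cardinal.{u}} {X : ZFSet.{u}} {S : Set ZFSet.{u}}

theorem _root_.IsClub.mem_of_forall_lt_exists {α : Type*} [LinearOrder α] {t : Set α}
    (ht : IsClub t) {m : α} (hm : ∃ a, a < m) (h : ∀ a < m, ∃ b ∈ t, a < b ∧ b < m) : m ∈ t := by
  refine ht.isLUB_mem (t := {b ∈ t | b < m}) (fun b hb => hb.1) ?_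
    ⟨fun b hb => hb.2.le, fun c hc => ?_⟩
  · obtain ⟨a, ha⟩ := hm
    obtain ⟨b, hb, -, hbm⟩ := h a ha
    exact ⟨b, hb, hbm⟩
  · by_contra! hlt
    obtain ⟨b, hb, hcb, hbm⟩ := h c hlt
    exact (hc ⟨hb, hbm⟩).not_gt hcb

theorem exists_mem_club_gt (hκ : ℵ₀ ≤ κ) {t : Set (Set.Iio κ.ord)} (ht : IsClub t)
    {a : Ordinal.{u}} (ha : a < κ.ord) : ∃ b, a < b ∧ ∃ h : b < κ.ord, ⟨b, h⟩ ∈ t := by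
  obtain ⟨b, hb, hab⟩ := ht.isCofinal ⟨a + 1, (isSuccLimit_ord hκ).add_one_lt ha⟩
  exact ⟨b.1, (lt_add_one a).trans_le hab, b.2, hb⟩

/-- An inaccessible `κ` is Mahlo as soon as every club in `κ` is unbounded below some regular
`μ < κ`. -/
theorem isMahlo_of_forall_club (hκ : κ.IsInaccessible)
    (h : ∀ t : Set (Set.Iio κ.ord), IsClub t → ∃ μ < κ, μ.IsRegular ∧
      ∀ a < μ.ord, ∃ b, a < b ∧ b < μ.ord ∧ ∃ hb : b < κ.ord, ⟨b, hb⟩ ∈ t) : IsMahlo κ := by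
  refine ⟨hκ, fun t ht => ?_⟩
  obtain ⟨μ, hμκ, hμ, hμt⟩ := h t ht
  refine ⟨⟨μ.ord, ord_lt_ord.2 hμκ⟩, ⟨μ, hμ, rfl⟩, ht.mem_of_forall_lt_exists ?_ ?_⟩
  · exact ⟨⟨0, hκ.isRegular.ord_pos⟩, hμ.ord_pos⟩
  · intro a ha
    obtain ⟨b, hab, hbμ, hb, hbt⟩ := hμt a.1 ha
    exact ⟨_, hbt, hab, hbμ⟩

/-- Given a club `t`, choose a point closed under `inaccessibleClosure` and under `a ↦ n a`, a
member of `t` above `a`. Then `κ_x` is inaccessible and `t` is unbounded below it. -/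
theorem IsStronglyStationary.isMahlo (hS : IsStronglyStationary κ X S) (hκ : κ.IsInaccessible)
    (hX : ordSet κ ⊆ X) : IsMahlo κ := by
  refine isMahlo_of_forall_club hκ fun t ht => ?_
  have hex (a : Ordinal.{u}) : ∃ b, a < κ.ord → a < b ∧ ∃ h : b < κ.ord, ⟨b, h⟩ ∈ t := by
    by_cases ha : a < κ.ord
    · obtain ⟨b, hb⟩ := exists_mem_club_gt hκ.aleph0_lt.le ht ha
      exact ⟨b, fun _ => hb⟩
    · exact ⟨0, fun h => absurd h ha⟩
  choose n hn using hex
  obtain ⟨x, ⟨-, hx⟩, hxn⟩ := (hS.inter_closureSet hκ.aleph0_lt.le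
    (mapsTo_inaccessibleClosure hκ hX))
    (fun w => biUnion (w ∩ ordSet κ) fun z => {(n z.rank).toZFSet}) (by
      intro w hw
      refine ⟨fun z hz => ?_, card_biUnion_lt hκ.isRegular
        ((ZFSet.card_mono fun _ h => (ZFSet.mem_inter.1 h).1).trans_lt hw.2) fun y _ => ?_⟩
      · obtain ⟨y, hy, hzy⟩ := mem_biUnion.1 hz
        obtain ⟨a, ha, rfl⟩ := mem_ordSet.1 (ZFSet.mem_inter.1 hy).2
        rw [ZFSet.mem_singleton.1 hzy, Ordinal.rank_toZFSet]
        exact hX (toZFSet_mem_ordSet.2 (hn a ha).2.1)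
      · rw [ZFSet.card_singleton]
        exact one_lt_aleph0.trans hκ.aleph0_lt)
  obtain ⟨hxκ, hin⟩ := isInaccessible_kap_of_mem_closureSet hκ hX hx
  have hμκ := kap_lt_of_mem_Pk hx.1
  refine ⟨kap κ x, hμκ, hin.isRegular, fun a ha => ?_⟩
  have haκ := ha.trans (ord_lt_ord.2 hμκ)
  have hax : a.toZFSet ∈ x := by
    have := toZFSet_mem_ordSet.2 ha
    rw [← hxκ] at this
    exact (ZFSet.mem_inter.1 this).1
  obtain ⟨hab, hbκ, hbt⟩ := hn a haκ
  refine ⟨n a, hab, ?_, hbκ, hbt⟩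
  have hbx : (n a).toZFSet ∈ x := by
    refine hxn.2.2 {a.toZFSet} (singleton_mem_Pk (one_lt_aleph0.trans hin.aleph0_lt) hax)
      (mem_biUnion.2 ⟨a.toZFSet, ZFSet.mem_inter.2 ⟨ZFSet.mem_singleton.2 rfl,
        toZFSet_mem_ordSet.2 haκ⟩, ?_⟩)
    rw [Ordinal.rank_toZFSet]
    exact ZFSet.mem_singleton.2 rfl
  have : (n a).toZFSet ∈ x ∩ ordSet κ := ZFSet.mem_inter.2 ⟨hbx, toZFSet_mem_ordSet.2 hbκ⟩
  rwa [hxκ, toZFSet_mem_ordSet] at this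

/-- The closure points of a function on a regular uncountable cardinal form a club. -/
theorem isClub_closurePoints (hκ : κ.IsRegular) (hunc : ℵ₀ < κ) {g : Ordinal.{u} → Ordinal.{u}}
    (hg : ∀ a < κ.ord, g a < κ.ord) :
    IsClub {m : Set.Iio κ.ord | ∀ a < m.1, g a < m.1} := by
  refine ⟨fun d hd _ _ m hm a ha => ?_, fun a => ?_⟩
  · obtain ⟨b, hb, hab⟩ := (lt_isLUB_iff (a := m) (b := ⟨a, lt_trans ha m.2⟩) hm).1 ha
    exact (hd hb a hab).trans_le (hm.1 hb)
  · let g' : Ordinal.{u} → Ordinal.{u} := fun a => ⨆ b : Set.Iio a, g b + 1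
    have hg' : ∀ a < κ.ord, g' a < κ.ord := by
      intro a ha
      refine Ordinal.lift_iSup_add_one_lt_of_lt_cof ?_ fun b => hg b (lt_trans b.2 ha)
      rw [← Ordinal.lift_cof, hκ.cof_ord, mk_Iio_ordinal, lift_lift, lift_lt]
      exact lt_ord.1 ha
    refine ⟨⟨Ordinal.nfp g' a, nfp_lt_ord_of_isRegular hκ hunc.ne' hg' a.2⟩, fun b hb => ?_,
      Ordinal.le_nfp g' a⟩
    obtain ⟨n, hn⟩ := Ordinal.lt_nfp_iff.1 hb
    refine lt_of_lt_of_le ?_ (Ordinal.iterate_le_nfp g' a (n + 1))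
    rw [Function.iterate_succ_apply']
    exact Ordinal.lt_iSup_add_one (fun b : Set.Iio (g'^[n] a) => g b) ⟨b, hn⟩

theorem IsMahlo.exists_isRegular_closed (hκ : IsMahlo κ) {g : Ordinal.{u} → Ordinal.{u}}
    (hg : ∀ a < κ.ord, g a < κ.ord) :
    ∃ μ < κ, μ.IsRegular ∧ ∀ a < μ.ord, g a < μ.ord := by
  obtain ⟨m, ⟨μ, hμ, hm⟩, hc⟩ := hκ.2 (isClub_closurePoints hκ.1.isRegular hκ.1.aleph0_lt hg)
  have hmκ : m.1 < κ.ord := m.2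
  rw [← hm, ord_lt_ord] at hmκ
  refine ⟨μ, hmκ, hμ, ?_⟩
  rw [hm]
  exact hc

end Mahlo

/-! ### Cofinality of `B_f` at a Mahlo cardinal -/

section ClosureChain

variable {κ : Cardinal.{u}} {X w : ZFSet.{u}} {f : ZFSet.{u} → ZFSet.{u}} {i j : Ordinal.{u}}

/-- The increasing continuous chain starting from `w`, whose `(i + 1)`-st member contains `i`
and the values of `f` at all subsets of the `i`-th member. -/
noncomputable def closureChain (f : ZFSet.{u} → ZFSet.{u}) (w : ZFSet.{u}) (i : Ordinal.{u}) :
    ZFSet.{u} :=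
  w ∪ ZFSet.iUnion fun j : Set.Iio i => insert j.1.toZFSet
    (closureChain f w j.1 ∪ biUnion (ZFSet.powerset (closureChain f w j.1)) f)
termination_by i
decreasing_by exact j.2

theorem mem_closureChain {z : ZFSet.{u}} : z ∈ closureChain f w i ↔
    z ∈ w ∨ ∃ j < i, z = j.toZFSet ∨ z ∈ closureChain f w j ∨
      ∃ v ⊆ closureChain f w j, z ∈ f v := by
  rw [closureChain]
  simp

theorem closureChain_mono (f : ZFSet.{u} → ZFSet.{u}) (w : ZFSet.{u}) :
    Monotone (closureChain f w) := by
  intro i j hij z hz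
  rcases hij.eq_or_lt with rfl | h
  · exact hz
  · exact mem_closureChain.2 (Or.inr ⟨i, h, Or.inr (Or.inl hz)⟩)

theorem exists_mem_closureChain_of_isSuccLimit (hi : IsSuccLimit i) {z : ZFSet.{u}}
    (hz : z ∈ closureChain f w i) : ∃ j < i, z ∈ closureChain f w j := by
  rcases mem_closureChain.1 hz with h | ⟨j, hj, h⟩
  · exact ⟨0, hi.bot_lt, mem_closureChain.2 (Or.inl h)⟩
  · exact ⟨j + 1, hi.add_one_lt hj, mem_closureChain.2 (Or.inr ⟨j, lt_add_one j, h⟩)⟩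

/-- The strong limit property bounds the number of subsets of a stage, and regularity bounds the
unions. -/
theorem closureChain_mem_Pk (hκ : κ.IsInaccessible) (hX : ordSet κ ⊆ X)
    (hf : Set.MapsTo f (Pk κ X) (Pk κ X)) (hw : w ∈ Pk κ X) (hi : i < κ.ord) :
    closureChain f w i ∈ Pk κ X := by
  induction i using WellFoundedLT.induction with
  | ind i ih =>
  have hsub (j : Ordinal.{u}) (hj : j < i) {v : ZFSet.{u}} (hv : v ⊆ closureChain f w j) :
      v ∈ Pk κ X :=
    ⟨hv.trans (ih j hj (hj.trans hi)).1,
      (ZFSet.card_mono hv).trans_lt (ih j hj (hj.trans hi)).2⟩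
  constructor
  · intro z hz
    rcases mem_closureChain.1 hz with h | ⟨j, hj, rfl | h | ⟨v, hv, h⟩⟩
    · exact hw.1 h
    · exact hX (toZFSet_mem_ordSet.2 (hj.trans hi))
    · exact (ih j hj (hj.trans hi)).1 h
    · exact (hf (hsub j hj hv)).1 h
  · have hle : closureChain f w i ⊆ w ∪ biUnion i.toZFSet fun z => insert z
        (closureChain f w z.rank ∪ biUnion (ZFSet.powerset (closureChain f w z.rank)) f) := by
      intro z hz
      rw [ZFSet.mem_union, mem_biUnion]
      rcases mem_closureChain.1 hz with h | ⟨j, hj, h⟩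
      · exact Or.inl h
      · refine Or.inr ⟨j.toZFSet, Ordinal.toZFSet_mem_toZFSet_iff.2 hj, ?_⟩
        simpa using h
    refine (ZFSet.card_mono hle).trans_lt (card_union_lt hκ.aleph0_lt.le hw.2
      (card_biUnion_lt hκ.isRegular ?_ fun y hy => ?_))
    · rw [Ordinal.card_toZFSet]
      exact lt_ord.1 hi
    · obtain ⟨j, hj, rfl⟩ := Ordinal.mem_toZFSet_iff.1 hy
      rw [Ordinal.rank_toZFSet]
      have hjP := ih j hj (hj.trans hi)
      refine card_insert_lt hκ.aleph0_lt.le (card_union_lt hκ.aleph0_lt.le hjP.2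
        (card_biUnion_lt hκ.isRegular ?_ fun v hv =>
          (hf (hsub j hj (ZFSet.mem_powerset.1 hv))).2))
      rw [ZFSet.card_powerset]
      exact hκ.isStrongPrelimit hjP.2

/-- If `κ` is Mahlo, then every set `B_f` is `≺`-cofinal in `P_κ X`. -/
theorem IsMahlo.exists_prec_mem_closureSet (hκ : IsMahlo κ) (hX : ordSet κ ⊆ X)
    (hf : Set.MapsTo f (Pk κ X) (Pk κ X)) (hw : w ∈ Pk κ X) :
    ∃ u ∈ closureSet κ X f, Prec κ w u := by
  have hex (i : Ordinal.{u}) : ∃ β, i < κ.ord → β < κ.ord ∧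
      ∀ a < κ.ord, a.toZFSet ∈ closureChain f w i → a < β := by
    by_cases hi : i < κ.ord
    · obtain ⟨β, h⟩ := exists_bound_of_card_lt hκ.1.isRegular
        (closureChain_mem_Pk hκ.1 hX hf hw hi).2
      exact ⟨β, fun _ => h⟩
    · exact ⟨0, fun h => absurd h hi⟩
  choose β hβ using hex
  -- Closure under `β` keeps the ordinals below `κ` of the earlier stages under `μ`, so stage `μ`
  -- meets `κ` exactly in `μ`; closure under the cardinalities gives `|w| < μ`.
  obtain ⟨μ, hμκ, hμ, hcl⟩ := hκ.exists_isRegular_closed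
    (g := fun i => max (β i) (closureChain f w i).card.ord) fun i hi =>
      max_lt (hβ i hi).1 (ord_lt_ord.2 (closureChain_mem_Pk hκ.1 hX hf hw hi).2)
  have hμo : μ.ord < κ.ord := ord_lt_ord.2 hμκ
  have hlim : IsSuccLimit μ.ord := isSuccLimit_ord hμ.aleph0_le
  have hwi (i : Ordinal.{u}) : w ⊆ closureChain f w i :=
    fun z hz => mem_closureChain.2 (Or.inl hz)
  have hP := closureChain_mem_Pk hκ.1 hX hf hw hμo
  have hsub : ordSet μ ⊆ closureChain f w μ.ord := by
    intro z hz
    obtain ⟨a, ha, rfl⟩ := mem_ordSet.1 hz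
    exact mem_closureChain.2 (Or.inr ⟨a, ha, Or.inl rfl⟩)
  have heq : closureChain f w μ.ord ∩ ordSet κ = ordSet μ := by
    refine le_antisymm (fun z hz => ?_)
      fun z hz => ZFSet.mem_inter.2 ⟨hsub hz, ordSet_subset_ordSet.2 hμκ.le hz⟩
    obtain ⟨hz, hzκ⟩ := ZFSet.mem_inter.1 hz
    obtain ⟨a, ha, rfl⟩ := mem_ordSet.1 hzκ
    obtain ⟨j, hj, hzj⟩ := exists_mem_closureChain_of_isSuccLimit hlim hz
    exact toZFSet_mem_ordSet.2 (((hβ j (hj.trans hμo)).2 a ha hzj).trans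
      ((le_max_left _ _).trans_lt (hcl j hj)))
  have hkap : kap κ (closureChain f w μ.ord) = μ := by rw [kap, heq, card_ordSet]
  refine ⟨closureChain f w μ.ord, ⟨hP, ?_, ?_⟩, hwi _, ?_⟩
  · intro h
    rw [kap, h, ZFSet.card_empty] at hkap
    exact hμ.ne_zero hkap.symm
  · intro v hv
    rw [hkap] at hv
    have hex (y : ZFSet.{u}) : ∃ j, y ∈ v → j < μ.ord ∧ y ∈ closureChain f w j := by
      by_cases hy : y ∈ v
      · obtain ⟨j, hj⟩ := exists_mem_closureChain_of_isSuccLimit hlim (hv.1 hy)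
        exact ⟨j, fun _ => hj⟩
      · exact ⟨0, fun h => absurd h hy⟩
    choose j hj using hex
    -- Here regularity of `μ` is used: fewer than `μ` elements of `v` have all entered by one stage
    -- `γ < μ`, and the next stage contains `f v`.
    obtain ⟨γ, hγ, hjγ⟩ := exists_bound_of_card_lt hμ (card_biUnion_lt hμ hv.2
      (F := fun y => {(j y).toZFSet}) fun y _ => by
        rw [ZFSet.card_singleton]; exact one_lt_aleph0.trans_le hμ.aleph0_le)
    intro z hz
    refine mem_closureChain.2 (Or.inr ⟨γ, hγ, Or.inr (Or.inr ⟨v, fun y hy => ?_, hz⟩)⟩)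
    refine closureChain_mono f w (hjγ (j y) (hj y hy).1 ?_).le (hj y hy).2
    exact mem_biUnion.2 ⟨y, hy, ZFSet.mem_singleton.2 rfl⟩
  · rw [hkap]
    refine (ZFSet.card_mono (hwi 0)).trans_lt (ord_lt_ord.1 ?_)
    exact (le_max_right _ _).trans_lt (hcl 0 hμ.ord_pos)

end ClosureChain

/-! ### Strong versus 1-s-strong stationarity -/

section SStrongStationarity

variable {κ μ : Cardinal.{u}} {X x y : ZFSet.{u}} {S U : Set ZFSet.{u}}

theorem isSStronglyStationary_one : IsSStronglyStationary κ X 1 S x ↔ IsSuccLimit (kap κ x) ∧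
    ∀ U V : Set ZFSet.{u}, U ⊆ Pk κ X → V ⊆ Pk κ X →
      IsPrecCofinal κ U x → IsPrecCofinal κ V x →
      ∃ y ∈ S ∩ Pk (kap κ x) x, IsPrecCofinal κ U y ∧ IsPrecCofinal κ V y := by
  rw [isSStronglyStationary_of_ne_zero one_ne_zero]
  simp only [Order.lt_one_iff, forall_eq, isSStronglyStationary_zero]

theorem isPrecCofinal_congr (hx : x ∩ ordSet κ = ordSet μ) (hyx : y ⊆ x) :
    IsPrecCofinal κ U y ↔ IsPrecCofinal μ U y := by
  simp only [IsPrecCofinal, kap_eq_kap hx hyx, Prec]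
  refine forall₂_congr fun v hv => exists_congr fun z => and_congr_right fun hz => ?_
  rw [kap_eq_kap hx (hz.2.1.trans hyx)]

theorem isPrecCofinal_inter_Pk (hyx : y ⊆ x) (hy : kap κ y ≤ μ) :
    IsPrecCofinal κ (U ∩ Pk μ x) y ↔ IsPrecCofinal κ U y := by
  refine forall₂_congr fun v hv => exists_congr fun z => ?_
  refine ⟨fun h => ⟨⟨h.1.1.1, h.1.2⟩, h.2⟩, fun h => ⟨⟨⟨h.1.1, ?_⟩, h.1.2⟩, h.2⟩⟩
  exact mem_Pk_trans h.1.2 hyx hy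

/-- `1`-s-strong stationarity in `P_{κ_x} x` does not depend on the ambient space. -/
theorem isSStronglyStationary_one_localize (hx : x ∩ ordSet κ = ordSet μ) (hxX : x ⊆ X)
    (hμ : μ ≤ κ) : IsSStronglyStationary κ X 1 S x ↔ IsSStronglyStationary μ x 1 S x := by
  have hk : kap κ x = μ := by rw [kap, hx, card_ordSet]
  have hk' : kap μ x = μ := by rw [← kap_eq_kap hx subset_rfl, hk]
  rw [isSStronglyStationary_one, isSStronglyStationary_one, hk, hk']
  refine and_congr_right fun _ => ⟨fun h U V hU hV hUx hVx => ?_, fun h U V hU hV hUx hVx => ?_⟩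
  · obtain ⟨y, hy, h1, h2⟩ := h U V (fun z hz => mem_Pk_trans (hU hz) hxX hμ)
      (fun z hz => mem_Pk_trans (hV hz) hxX hμ)
      ((isPrecCofinal_congr hx subset_rfl).2 hUx) ((isPrecCofinal_congr hx subset_rfl).2 hVx)
    exact ⟨y, hy, (isPrecCofinal_congr hx hy.2.1).1 h1, (isPrecCofinal_congr hx hy.2.1).1 h2⟩
  · obtain ⟨y, hy, h1, h2⟩ := h (U ∩ Pk μ x) (V ∩ Pk μ x) (fun z hz => hz.2) (fun z hz => hz.2)
      ((isPrecCofinal_congr hx subset_rfl).1 ((isPrecCofinal_inter_Pk subset_rfl hk.le).2 hUx))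
      ((isPrecCofinal_congr hx subset_rfl).1 ((isPrecCofinal_inter_Pk subset_rfl hk.le).2 hVx))
    have hyμ : kap κ y ≤ μ := kap_le_card.trans hy.2.2.le
    exact ⟨y, hy, (isPrecCofinal_inter_Pk hy.2.1 hyμ).1 ((isPrecCofinal_congr hx hy.2.1).2 h1),
      (isPrecCofinal_inter_Pk hy.2.1 hyμ).1 ((isPrecCofinal_congr hx hy.2.1).2 h2)⟩

/-- For `U` `≺`-cofinal in `P_κ X`, the points of some `B_f` all reflect the cofinality of `U`. -/
theorem IsPrecCofinal.exists_closureSet (hκ : ℵ₀ ≤ κ) (hlim : IsSuccLimit κ)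
    (hX : ordSet κ ⊆ X) (hU : IsPrecCofinal κ U X) :
    ∃ f : ZFSet.{u} → ZFSet.{u}, Set.MapsTo f (Pk κ X) (Pk κ X) ∧
      ∀ y ∈ closureSet κ X f, IsPrecCofinal κ U y := by
  have hex (v : ZFSet.{u}) : ∃ u, v ∈ Pk κ X → u ∈ U ∩ Pk κ X ∧ Prec κ v u := by
    by_cases hv : v ∈ Pk κ X
    · rw [IsPrecCofinal, kap_self hX] at hU
      obtain ⟨u, hu⟩ := hU v hv
      exact ⟨u, fun _ => hu⟩
    · exact ⟨∅, fun h => absurd h hv⟩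
  choose g hg using hex
  -- The second part forces `|g v| < κ_y`, so that `g v` lies in `P_{κ_y} y` and not merely in the
  -- power set of `y`.
  refine ⟨fun v => g v ∪ ordSet (succ (g v).card), fun v hv => ?_, fun y hy v hv => ?_⟩
  · have h := (hg v hv).1.2
    exact union_mem_Pk hκ h (ordSet_mem_Pk hX (hlim.succ_lt h.2))
  · have hvX : v ∈ Pk κ X := mem_Pk_trans hv hy.1.1 (kap_lt_of_mem_Pk hy.1).le
    have h := hy.2.2 v hv
    obtain ⟨⟨hgU, hgP⟩, hpr⟩ := hg v hvX
    refine ⟨g v, ⟨hgU, fun z hz => h (ZFSet.mem_union.2 (Or.inl hz)), ?_⟩, hpr⟩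
    exact (lt_succ _).trans_le (le_kap_of_subset
      (fun z hz => h (ZFSet.mem_union.2 (Or.inr hz))) (hlim.succ_lt hgP.2).le)

/-- Strongly stationary sets are `1`-s-strongly stationary. -/
theorem IsStronglyStationary.isSStronglyStationary_one (hS : IsStronglyStationary κ X S)
    (hκ : ℵ₀ ≤ κ) (hlim : IsSuccLimit κ) (hX : ordSet κ ⊆ X) :
    IsSStronglyStationary κ X 1 S X := by
  rw [TwoCardinal.isSStronglyStationary_one, kap_self hX]
  refine ⟨hlim, fun U V _ _ hU hV => ?_⟩
  obtain ⟨f, hf, hfU⟩ := hU.exists_closureSet hκ hlim hX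
  obtain ⟨g, hg, hgV⟩ := hV.exists_closureSet hκ hlim hX
  obtain ⟨y, ⟨hyS, hyf⟩, hyg⟩ := hS.inter_closureSet hκ hf g hg
  exact ⟨y, ⟨hyS, hyf.1⟩, hfU y hyf, hgV y hyg⟩

/-- If `κ` is Mahlo, then `1`-s-strongly stationary sets are strongly stationary, apart from the
degenerate points with `κ_y = 0`, at which every set is `≺`-cofinal. -/
theorem IsSStronglyStationary.isStronglyStationary (hS : IsSStronglyStationary κ X 1 S X)
    (hκ : IsMahlo κ) (hX : ordSet κ ⊆ X) (h0 : ∀ y ∈ S ∩ Pk κ X, kap κ y ≠ 0) :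
    IsStronglyStationary κ X S := by
  intro f hf
  rw [isSStronglyStationary_one, kap_self hX] at hS
  have hcof : IsPrecCofinal κ (closureSet κ X f) X := by
    intro v hv
    rw [kap_self hX] at hv ⊢
    obtain ⟨u, hu, hvu⟩ := hκ.exists_prec_mem_closureSet hX hf hv
    exact ⟨u, ⟨hu, hu.1⟩, hvu⟩
  obtain ⟨y, hy, hyf, -⟩ := hS.2 _ _ closureSet_subset_Pk closureSet_subset_Pk hcof hcof
  refine ⟨y, hy.1, hy.2, fun h => h0 y hy (by rw [kap, h, ZFSet.card_empty]), fun v hv => ?_⟩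
  -- From `v ≺ u ∈ B_f` and `u ⊆ y` it follows that `f v ⊆ u ⊆ y`.
  obtain ⟨u, ⟨huf, hu⟩, hvu⟩ := hyf v hv
  exact (huf.2.2 v hvu).trans hu.1

/-- As `y ∩ κ` need not be a cardinal, `κ_u` is enlarged by adding any `|w|⁺` elements of `y ∩ κ`.
-/
theorem exists_prec_mem_Pk (hlim : IsSuccLimit (kap κ y)) (hω : ℵ₀ ≤ kap κ y) {w : ZFSet.{u}}
    (hw : w ∈ Pk (kap κ y) y) : ∃ u ∈ Pk (kap κ y) y, Prec κ w u := by
  have hs := hlim.succ_lt hw.2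
  obtain ⟨s, hsy, hsc⟩ := exists_subset_card_eq (x := y ∩ ordSet κ) hs.le
  refine ⟨w ∪ s, union_mem_Pk hω hw ⟨fun z hz => (ZFSet.mem_inter.1 (hsy hz)).1, by rwa [hsc]⟩,
    fun z hz => ZFSet.mem_union.2 (Or.inl hz), (lt_succ w.card).trans_le ?_⟩
  rw [← hsc]
  exact ZFSet.card_mono fun z hz => ZFSet.mem_inter.2
    ⟨ZFSet.mem_union.2 (Or.inr hz), (ZFSet.mem_inter.1 (hsy hz)).2⟩

/-- A space in which a set of inaccessible points is `1`-s-strongly stationary is Mahlo. -/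
theorem IsSStronglyStationary.isMahlo_kap (hS : IsSStronglyStationary κ X 1 S y)
    (hy : y ∈ Pk κ X)
    (hin : ∀ z ∈ S, z ∩ ordSet κ = ordSet (kap κ z) ∧ (kap κ z).IsInaccessible) :
    y ∩ ordSet κ = ordSet (kap κ y) ∧ IsMahlo (kap κ y) := by
  obtain ⟨hlim, hS⟩ := isSStronglyStationary_one.1 hS
  have hμκ : kap κ y < κ := kap_lt_of_mem_Pk hy
  have hPX {c : ZFSet.{u}} (hc : c ∈ Pk (kap κ y) y) : c ∈ Pk κ X := mem_Pk_trans hc hy.1 hμκ.le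
  have hzs {z : ZFSet.{u}} (hz : z ∈ S) : ordSet (kap κ z) ⊆ z := by
    rw [← (hin z hz).1]; exact fun _ h => (ZFSet.mem_inter.1 h).1
  have hω : ℵ₀ ≤ kap κ y := aleph0_le_of_isSuccLimit hlim
  -- The cone above `c` is cofinal in `y`; at a point `z ∈ S` where it remains cofinal, some `u ≺ z`
  -- contains `c`. Thus `y ∩ κ` is covered by the cardinals `κ_z`, which pass their inaccessibility
  -- on to `κ_y`.
  have cover : ∀ c ∈ Pk (kap κ y) y, ∃ z ∈ S ∩ Pk (kap κ y) y, c ⊆ z ∧ c.card < kap κ z := by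
    intro c hc
    have hU : IsPrecCofinal κ {u ∈ Pk κ X | c ⊆ u} y := by
      intro w hw
      obtain ⟨u, hu, hwu⟩ := exists_prec_mem_Pk hlim hω (union_mem_Pk hω hw hc)
      refine ⟨u, ⟨⟨hPX hu, fun z hz => hwu.1 (ZFSet.mem_union.2 (Or.inr hz))⟩, hu⟩,
        fun z hz => hwu.1 (ZFSet.mem_union.2 (Or.inl hz)), lt_of_le_of_lt ?_ hwu.2⟩
      exact ZFSet.card_mono fun z hz => ZFSet.mem_union.2 (Or.inl hz)
    obtain ⟨z, hz, hzU, -⟩ := hS _ _ (fun u hu => hu.1) (fun u hu => hu.1) hU hU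
    obtain ⟨u, ⟨hu, huz⟩, -⟩ := hzU ∅ (empty_mem_Pk (hin z hz.1).2.ne_zero)
    exact ⟨z, hz, hu.2.trans huz.1, (ZFSet.card_mono hu.2).trans_lt huz.2⟩
  have heq : y ∩ ordSet κ = ordSet (kap κ y) := by
    refine inter_ordSet_eq_ordSet_kap fun a ha hay => ?_
    obtain ⟨z, hz, hcz, -⟩ := cover _ (singleton_mem_Pk (one_lt_aleph0.trans_le hω) hay)
    refine ⟨kap κ z, (kap_mono hz.2.1).trans hμκ.le, ?_, (hzs hz.1).trans hz.2.1⟩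
    have : a.toZFSet ∈ z ∩ ordSet κ :=
      ZFSet.mem_inter.2 ⟨hcz (ZFSet.mem_singleton.2 rfl), toZFSet_mem_ordSet.2 ha⟩
    rwa [(hin z hz.1).1, toZFSet_mem_ordSet] at this
  have hys : ordSet (kap κ y) ⊆ y := ordSet_subset_of_inter_eq heq
  have hlt {z : ZFSet.{u}} (hz : z ∈ Pk (kap κ y) y) : kap κ z < kap κ y :=
    kap_le_card.trans_lt hz.2
  have hyin : (kap κ y).IsInaccessible := by
    obtain ⟨z₀, hz₀, -⟩ := cover ∅ (empty_mem_Pk hlim.ne_bot)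
    refine isInaccessible_def.2 ⟨(hin z₀ hz₀.1).2.aleph0_lt.trans (hlt hz₀.2), ?_, hlim.ne_bot, ?_⟩
    · refine isRegular_of_exists_bound hω fun c hc hcc => ?_
      obtain ⟨z, hz, hcz, -⟩ := cover c ⟨hc.trans hys, hcc⟩
      refine ⟨(kap κ z).ord, ord_lt_ord.2 (hlt hz.2), fun a ha => ?_⟩
      have haκ : a.toZFSet ∈ ordSet κ := ordSet_subset_ordSet.2 hμκ.le (hc ha)
      have : a.toZFSet ∈ z ∩ ordSet κ := ZFSet.mem_inter.2 ⟨hcz ha, haκ⟩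
      rwa [(hin z hz.1).1, toZFSet_mem_ordSet] at this
    · intro ν hν
      obtain ⟨z, hz, -, hνz⟩ := cover _ (ordSet_mem_Pk hys hν)
      rw [card_ordSet] at hνz
      exact ((hin z hz.1).2.isStrongPrelimit hνz).trans (hlt hz.2)
  refine ⟨heq, isMahlo_of_forall_club hyin fun t ht => ?_⟩
  -- These are the `u` whose trace on `κ` is an element `b` of the club. If `U` is cofinal at `z`,
  -- some `u ∈ U` satisfies `{a} ≺ u ≺ z` for each `a < κ_z`, and its trace is a member of `t`
  -- between `a` and `κ_z`.
  let U : Set ZFSet.{u} := {u ∈ Pk κ X | ∃ b, (∃ h : b < (kap κ y).ord, ⟨b, h⟩ ∈ t) ∧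
    b.toZFSet ⊆ u ∧ ∀ a < κ.ord, a.toZFSet ∈ u → a < b}
  have hU : IsPrecCofinal κ U y := by
    intro w hw
    obtain ⟨β, hβ, hwβ⟩ := exists_bound_of_card_lt hyin.isRegular hw.2
    -- Choosing `b` above `|w|⁺` as well ensures `|w| < κ_u` for `u = w ∪ b`.
    have hs : (succ w.card).ord < (kap κ y).ord := ord_lt_ord.2 (hlim.succ_lt hw.2)
    obtain ⟨b, hb, hbμ, hbt⟩ := exists_mem_club_gt hω ht (max_lt hβ hs)
    have hbκ : b.toZFSet ⊆ ordSet κ :=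
      toZFSet_subset_ordSet.2 (hbμ.trans (ord_lt_ord.2 hμκ)).le
    have hbP : b.toZFSet ∈ Pk (kap κ y) y := ⟨(toZFSet_subset_ordSet.2 hbμ.le).trans hys, by
      rw [Ordinal.card_toZFSet]; exact lt_ord.1 hbμ⟩
    have huP := union_mem_Pk hω hw hbP
    refine ⟨w ∪ b.toZFSet, ⟨⟨hPX huP, b, ⟨hbμ, hbt⟩,
      fun z hz => ZFSet.mem_union.2 (Or.inr hz), fun a ha hau => ?_⟩, huP⟩,
      fun z hz => ZFSet.mem_union.2 (Or.inl hz), (lt_succ w.card).trans_le ?_⟩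
    · rcases ZFSet.mem_union.1 hau with h | h
      · have haμ : a < (kap κ y).ord := by
          have : a.toZFSet ∈ y ∩ ordSet κ :=
            ZFSet.mem_inter.2 ⟨hw.1 h, toZFSet_mem_ordSet.2 ha⟩
          rwa [heq, toZFSet_mem_ordSet] at this
        exact (hwβ a haμ h).trans ((le_max_left _ _).trans_lt hb)
      · exact Ordinal.toZFSet_mem_toZFSet_iff.1 h
    · have h : ordSet (succ w.card) ⊆ b.toZFSet :=
        Ordinal.toZFSet_subset_toZFSet_iff.2 ((le_max_right _ _).trans hb.le)
      exact le_kap_of_subset (fun z hz => ZFSet.mem_union.2 (Or.inr (h hz)))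
        ((hlim.succ_lt hw.2).le.trans hμκ.le)
  obtain ⟨z, hz, hzU, -⟩ := hS U U (fun u hu => hu.1) (fun u hu => hu.1) hU hU
  refine ⟨kap κ z, hlt hz.2, (hin z hz.1).2.isRegular, fun a ha => ?_⟩
  have haκ : a < κ.ord := ha.trans (ord_lt_ord.2 ((hlt hz.2).trans hμκ))
  obtain ⟨u, ⟨⟨-, b, ⟨hbμ, hbt⟩, hbu, hub⟩, huz⟩, hau⟩ := hzU {a.toZFSet}
    (singleton_mem_Pk (one_lt_aleph0.trans (hin z hz.1).2.aleph0_lt)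
      (hzs hz.1 (toZFSet_mem_ordSet.2 ha)))
  refine ⟨b, hub a haκ (hau.1 (ZFSet.mem_singleton.2 rfl)), ?_, hbμ, hbt⟩
  rw [lt_ord, ← Ordinal.card_toZFSet]
  exact (ZFSet.card_mono hbu).trans_lt huz.2

end SStrongStationarity

/-! ### Strongly stationary witnesses and the characterization -/

section Characterization

variable {κ : Cardinal.{u}} {X : ZFSet.{u}}

theorem isSStronglyStationary_two {A : Set ZFSet.{u}} {x : ZFSet.{u}} :
    IsSStronglyStationary κ X 2 A x ↔ IsSuccLimit (kap κ x) ∧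
      ∀ ζ : Ordinal.{u}, ζ = 0 ∨ ζ = 1 → ∀ S T : Set ZFSet.{u}, S ⊆ Pk κ X → T ⊆ Pk κ X →
        IsSStronglyStationary κ X ζ S x → IsSStronglyStationary κ X ζ T x →
        ∃ y ∈ A ∩ Pk (kap κ x) x,
          IsSStronglyStationary κ X ζ S y ∧ IsSStronglyStationary κ X ζ T y := by
  have h2 (ζ : Ordinal.{u}) : ζ < 2 ↔ ζ = 0 ∨ ζ = 1 := by
    rw [← one_add_one_eq_two, Order.lt_add_one_iff, le_iff_lt_or_eq, Order.lt_one_iff]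
  rw [isSStronglyStationary_of_ne_zero two_ne_zero]
  simp only [h2]

variable (κ X) in
/-- `S'` is a strongly stationary witness in `P_κ X` for the `ξ`-s-strong stationarity of `S`
at those Mahlo points where `S'` remains strongly stationary. -/
def TransfersTo (ξ : Ordinal.{u}) (S' S : Set ZFSet.{u}) : Prop :=
  S' ⊆ Pk κ X ∧ IsStronglyStationary κ X S' ∧
    ∀ x ∈ Pk κ X, x ∩ ordSet κ = ordSet (kap κ x) → IsMahlo (kap κ x) →
      IsStronglyStationary (kap κ x) x S' → IsSStronglyStationary κ X ξ S x

/-- The witness is a `B_f` at whose points `S` stays cofinal. If it is strongly stationary in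
`P_{κ_x} x`, every `v` lies `≺`-below some `z` in it, and cofinality of `S` at `z` supplies the
element above `v`. -/
theorem IsPrecCofinal.exists_transfersTo {S : Set ZFSet.{u}} (hS : IsPrecCofinal κ S X)
    (hκ : κ.IsInaccessible) (hX : ordSet κ ⊆ X) (hP : IsStronglyStationary κ X (Pk κ X)) :
    ∃ S', TransfersTo κ X 0 S' S := by
  obtain ⟨f, hf, hfS⟩ := hS.exists_closureSet hκ.aleph0_lt.le hκ.isSuccLimit hX
  refine ⟨closureSet κ X f, closureSet_subset_Pk,
    (hP.inter_closureSet hκ.aleph0_lt.le hf).mono Set.inter_subset_right, ?_⟩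
  intro x hx hxκ hM hxS
  rw [isSStronglyStationary_zero]
  intro v hv
  have hxs : ordSet (kap κ x) ⊆ x := ordSet_subset_of_inter_eq hxκ
  obtain ⟨z, ⟨hzf, hz⟩, hvz⟩ := hxS.exists_prec hM.1.aleph0_lt.le hM.1.isSuccLimit hxs hv
  obtain ⟨u, ⟨huS, hu⟩, hvu⟩ := hfS z hzf v
    ⟨hvz.1, by rw [kap_eq_kap hxκ hz.1]; exact hvz.2⟩
  exact ⟨u, ⟨huS, mem_Pk_trans hu hz.1 (kap_mono hz.1)⟩, hvu⟩

/-- Without degenerate points, `S` is its own witness. If some `y ∈ S` has `κ_y = 0`, then `P_{κ_y}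
y` is empty and `y` reflects every pair of sets, so it suffices that `y ∈ P_{κ_x} x`; the cone above
`y` is a witness for that. -/
theorem IsSStronglyStationary.exists_transfersTo {S : Set ZFSet.{u}} (hSP : S ⊆ Pk κ X)
    (hS : IsSStronglyStationary κ X 1 S X) (hκ : IsMahlo κ) (hX : ordSet κ ⊆ X)
    (hP : IsStronglyStationary κ X (Pk κ X)) : ∃ S', TransfersTo κ X 1 S' S := by
  by_cases h0 : ∀ y ∈ S, kap κ y ≠ 0
  · refine ⟨S, hSP, hS.isStronglyStationary hκ hX fun y hy => h0 y hy.1, ?_⟩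
    intro x hx hxκ hM hxS
    have hxs : ordSet (kap κ x) ⊆ x := ordSet_subset_of_inter_eq hxκ
    rw [isSStronglyStationary_one_localize hxκ hx.1 (kap_lt_of_mem_Pk hx).le]
    exact hxS.isSStronglyStationary_one hM.1.aleph0_lt.le hM.1.isSuccLimit hxs
  · push Not at h0
    obtain ⟨y, hyS, hy0⟩ := h0
    have hyP := hSP hyS
    refine ⟨{z ∈ Pk κ X | Prec κ y z}, fun z hz => hz.1, ?_, ?_⟩
    · have hs : succ y.card < κ := hκ.1.isSuccLimit.succ_lt hyP.2
      refine (hP.inter_closureSet hκ.1.aleph0_lt.le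
        (f := fun _ => y ∪ ordSet (succ y.card)) fun _ _ =>
          union_mem_Pk hκ.1.aleph0_lt.le hyP (ordSet_mem_Pk hX hs)).mono ?_
      rintro z ⟨hzP, hz⟩
      have h := hz.2.2 ∅ (empty_mem_Pk (kap_ne_zero_of_mem_closureSet hz))
      exact ⟨hzP, fun w hw => h (ZFSet.mem_union.2 (Or.inl hw)), (lt_succ _).trans_le
        (le_kap_of_subset (fun w hw => h (ZFSet.mem_union.2 (Or.inr hw))) hs.le)⟩
    · intro x hx hxκ hM hxS
      have hxs : ordSet (kap κ x) ⊆ x := ordSet_subset_of_inter_eq hxκ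
      obtain ⟨z, ⟨⟨-, hyz⟩, hz⟩, -⟩ := hxS.exists_prec hM.1.aleph0_lt.le hM.1.isSuccLimit hxs
        (empty_mem_Pk hM.1.ne_zero)
      have hyx : y ∈ Pk (kap κ x) x :=
        ⟨hyz.1.trans hz.1, hyz.2.trans_le (kap_mono hz.1)⟩
      have hyU (U : Set ZFSet.{u}) : IsPrecCofinal κ U y := by
        intro v hv
        rw [hy0] at hv
        exact absurd hv.2 (not_lt.2 (zero_le (a := v.card)))
      exact isSStronglyStationary_one.2 ⟨hM.1.isSuccLimit,
        fun U V _ _ _ _ => ⟨y, ⟨hyS, hyx⟩, hyU U, hyU V⟩⟩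

end Characterization

end TwoCardinal

open TwoCardinal
theorem mainTheorem4 (κ : Cardinal.{u}) (hreg : κ.IsRegular) (hunc : ℵ₀ < κ)
    (X : ZFSet.{u}) (hord : ∀ α ∈ X, ZFSet.IsOrdinal α) (hX : ordSet κ ⊆ X)
    (hind : IsPi11Indescribable κ X (Pk κ X))
    (A : Set ZFSet.{u}) (hA : A ⊆ Pk κ X) :
    IsSStronglyStationary κ X 2 A X ↔
      ∀ S T : Set ZFSet.{u}, S ⊆ Pk κ X → T ⊆ Pk κ X →
        IsStronglyStationary κ X S → IsStronglyStationary κ X T →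
        ∃ x ∈ A, x ∩ ordSet κ = ordSet (kap κ x) ∧ IsMahlo (kap κ x) ∧
          IsStronglyStationary (kap κ x) x S ∧ IsStronglyStationary (kap κ x) x T := by
  have hκ : κ.IsInaccessible := hind.isInaccessible hreg hunc hord hX
  have hP : IsStronglyStationary κ X (Pk κ X) := hind.isStronglyStationary_Pk hunc hord hX
  have hM : IsMahlo κ := hP.isMahlo hκ hX
  have hf := mapsTo_inaccessibleClosure hκ hX
  rw [isSStronglyStationary_two, kap_self hX]
  constructor
  · rintro ⟨-, h⟩ S T hSP hTP hS hT
    -- Intersecting with `C` makes all `κ_z` inaccessible, as needed for the Mahlo property of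
    -- `κ_x`, and also removes the degenerate points.
    let C := closureSet κ X (inaccessibleClosure κ)
    obtain ⟨x, ⟨hxA, hx⟩, hxS, hxT⟩ := h 1 (Or.inr rfl) (S ∩ C) (T ∩ C)
      (fun z hz => hSP hz.1) (fun z hz => hTP hz.1)
      ((hS.inter_closureSet hunc.le hf).isSStronglyStationary_one hunc.le hκ.isSuccLimit hX)
      ((hT.inter_closureSet hunc.le hf).isSStronglyStationary_one hunc.le hκ.isSuccLimit hX)
    obtain ⟨hxκ, hxM⟩ := hxS.isMahlo_kap hx
      fun z hz => isInaccessible_kap_of_mem_closureSet hκ hX hz.2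
    have hxs : ordSet (kap κ x) ⊆ x := ordSet_subset_of_inter_eq hxκ
    have local_stationary {S : Set ZFSet.{u}} (h : IsSStronglyStationary κ X 1 (S ∩ C) x) :
        IsStronglyStationary (kap κ x) x S := by
      rw [isSStronglyStationary_one_localize hxκ hx.1 (kap_lt_of_mem_Pk hx).le] at h
      refine (h.isStronglyStationary hxM hxs fun y hy => ?_).mono Set.inter_subset_left
      rw [← kap_eq_kap hxκ hy.2.1]
      exact kap_ne_zero_of_mem_closureSet hy.1.2
    exact ⟨x, hxA, hxκ, hxM, local_stationary hxS, local_stationary hxT⟩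
  · intro h
    refine ⟨hκ.isSuccLimit, fun ζ hζ S T hSP hTP hS hT => ?_⟩
    have transfer {S : Set ZFSet.{u}} (hSP : S ⊆ Pk κ X)
        (hS : IsSStronglyStationary κ X ζ S X) : ∃ S', TransfersTo κ X ζ S' S := by
      rcases hζ with rfl | rfl
      · exact (isSStronglyStationary_zero.1 hS).exists_transfersTo hκ hX hP
      · exact hS.exists_transfersTo hSP hM hX hP
    obtain ⟨S', hS'P, hS', hSS'⟩ := transfer hSP hS
    obtain ⟨T', hT'P, hT', hTT'⟩ := transfer hTP hT
    obtain ⟨x, hxA, hxκ, hxM, hxS, hxT⟩ := h S' T' hS'P hT'P hS' hT'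
    exact ⟨x, ⟨hxA, hA hxA⟩, hSS' x (hA hxA) hxκ hxM hxS, hTT' x (hA hxA) hxκ hxM hxT⟩
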